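/- Let $n\ge 1$ and $k\ge 0$ be integers, let $X$ be the set of $k$-subsets of $\{1,\dots,n\}$, and let $\mathcal F$ be the space of functions $f:X\to\mathbb C$, on which the symmetric group $S_n$ acts by $\sigma f=f\circ\sigma^{-1}$. For $1\le j\le n$ let $S_j\subseteq S_n$ be the subgroup of permutations fixing $j+1,\dots,n$, and for an irreducible representation $\lambda$ of $S_j$ let $\mathcal F_{j,\lambda}$ be the $\lambda$-isotypic component of $\mathcal F$ as an $S_j$-module. Let $\delta(x)$, $x\in X$, be the delta functions. For $1\le j\le n$ let $\mathcal F^{j,1}$ (respectively $\mathcal F^{j,2}$) be the span of those $\delta(x)$ with $j\in x$ (respectively $j\notin x$). For $1\le i\le n$, irreducible representations $\lambda_j$ of $S_j$ ($1\le j\le i$) and letters $c_{i+1},\dots,c_n\in\{1,2\}$, put $$\mathcal F_{\lambda_1\dots\lambda_i}^{c_{i+1}\dots c_n}=\mathcal F_{1,\lambda_1}\cap\dots\cap\mathcal F_{i,\lambda_i}\cap\mathcal F^{i+1,c_{i+1}}\cap\dots\cap\mathcal F^{n,c_n}.$$ An $i$-th intermediate basis is a basis of $\mathcal F$ each of whose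 elements lies in one of these subspaces; for $i=n$ this is a Gelfand–Tsetlin basis of $\mathcal F$. (Vectors may be ordered and scaled arbitrarily; orthonormal bases are a special case.) Let $B_0$ be the delta function basis, put $B_1=B_0$ (which is a first intermediate basis), and for $2\le i\le n$ let $B_i$ be any $i$-th intermediate basis. Write $[B]_{B'}$ for the change of basis matrix whose columns are the elements of $B$ written in the basis $B'$, and $[f]_B$ for the column vector of coordinates of $f$ in $B$. Computations are straight-line programs over $\mathbb C$. One operation evaluates $a+bc$, where each of $a,b,c$ is $0$, $1$, an input, or the result of an earlier operation; reading, copying and reordering values is free. **Theorem.** 1. For $i=2,\dots,n$, each column of $[B_{i-1}]_{B_i}$ has at most two nonzero entries. 2. $[B_0]_{B_n}=[B_{n-1}]_{B_n}\cdots[B_2]_{B_3}\,[B_1]_{B_2}$. 3. Suppose that the matrices $[B_{i-1}]_{B_i}$, $i=2,\dots,n$, are known, that is, their entries are inputs together with the entries of $[f]_{B_0}$. Then $$[f]_{B_n}=[B_0]_{B_n}\,[f]_{B_0}$$ can be computed with at most $2(n-1)\binom nk$ operations by applying the $n-1$ factors successively: there is a program of at most $2(n-1)\binom nk$ operations, which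 may depend on the bases but not on $f$, that outputs $[f]_{B_n}$ for every $f\in\mathcal F$. It is a concatenation of stages $2,\dots,n$ of at most $2\binom nk$ operations each, such that after stages $2,\dots,i$ the entries of $[f]_{B_i}$ are available, for every $1\le i\le n$ (for $i=1$, before any operation). -/

import Mathlib

noncomputable section

namespace JohnsonFFT

/-! ### The function space on the Johnson graph -/

/-- The set `X` of all `k`-subsets of an `n`-element set. The elements `1, …, n` are
represented by `0, …, n - 1` in `Fin n`. -/
abbrev KSet (n k : ℕ) : Type := Set.powersetCard (Fin n) k

/-- The space `𝓕` of complex valued functions on the set of `k`-sets. -/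
abbrev FunSpace (n k : ℕ) : Type := KSet n k → ℂ

/-- The action of the symmetric group on `𝓕`: `σ f = f ∘ σ⁻¹`. -/
def funRep (n k : ℕ) : Representation ℂ (Equiv.Perm (Fin n)) (FunSpace n k) where
  toFun σ := LinearMap.funLeft ℂ ℂ fun x : KSet n k => σ⁻¹ • x
  map_one' := by
    ext f x
    simp [LinearMap.funLeft]
  map_mul' σ τ := by
    ext f x
    simp [LinearMap.funLeft, mul_smul]

/-- The basis of delta functions. -/
def deltaBasis (n k : ℕ) : Module.Basis (KSet n k) ℂ (FunSpace n k) := Pi.basisFun ℂ (KSet n k)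

/-! ### Isotypic components for the chain `S_1 ⊂ S_2 ⊂ ⋯ ⊂ S_n` -/

/-- The subgroup `S_j` of the permutations fixing the last `n - j` elements. -/
def initialPerm (n j : ℕ) : Subgroup (Equiv.Perm (Fin n)) where
  carrier := {σ | ∀ m : Fin n, j ≤ (m : ℕ) → σ m = m}
  one_mem' := fun _ _ => rfl
  mul_mem' := by
    intro σ τ hσ hτ m hm
    rw [Equiv.Perm.mul_apply, hτ m hm, hσ m hm]
  inv_mem' := by
    intro σ hσ m hm
    rw [Equiv.Perm.inv_eq_iff_eq, hσ m hm]

/-- The space `𝓕` as a representation of `S_j`. -/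
def restrictedRep (n k j : ℕ) : Representation ℂ (initialPerm n j) (FunSpace n k) :=
  (funRep n k).comp (initialPerm n j).subtype

/-- `W` is one of the subspaces `𝓕_{j,λ}`: the isotypic component of `𝓕`, as a representation of
`S_j`, that corresponds to some irreducible representation `λ` of `S_j` occurring in `𝓕`. -/
def IsIsotypicSubspace (n k j : ℕ) (W : Submodule ℂ (FunSpace n k)) : Prop :=
  ∃ C ∈ isotypicComponents (MonoidAlgebra ℂ (initialPerm n j)) (restrictedRep n k j).asModule,
    W = (C.restrictScalars ℂ).map (restrictedRep n k j).asModuleEquiv.toLinearMap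

/-! ### Words and the intermediate bases

A `k`-set is identified with a word of length `n` in two letters: the letter at the place `j` is
the first letter (here `true`) if `j` belongs to the set, and the second (here `false`) if not. -/

/-- The subspace `𝓕^{j,c}`, spanned by the delta functions of the `k`-sets whose word has the
letter `c` in the place `j`. -/
def letterSubspace (n k : ℕ) (j : Fin n) (c : Bool) : Submodule ℂ (FunSpace n k) :=
  Submodule.span ℂ {f | ∃ x : KSet n k, (j ∈ (x : Finset (Fin n)) ↔ c = true) ∧
    f = deltaBasis n k x}

/-- The subspace `𝓕^{c_{i+1} … c_n}`; only the letters of `c` after the first `i` are used. -/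
def wordSubspace (n k i : ℕ) (c : Fin n → Bool) : Submodule ℂ (FunSpace n k) :=
  ⨅ j : Fin n, ⨅ _ : i ≤ (j : ℕ), letterSubspace n k j (c j)

/-- The subspace `𝓕_{λ_1 … λ_i} = 𝓕_{1,λ_1} ∩ ⋯ ∩ 𝓕_{i,λ_i}`, where `W j` stands for
`𝓕_{j,λ_j}`. -/
def chainSubspace (n k i : ℕ) (W : ℕ → Submodule ℂ (FunSpace n k)) :
    Submodule ℂ (FunSpace n k) :=
  ⨅ j ∈ Finset.Icc 1 i, W j

/-- `B` is an `i`-th intermediate basis of `𝓕`: a basis each of whose elements lies in one of the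
subspaces `𝓕_{λ_1 … λ_i}^{c_{i+1} … c_n} = 𝓕_{λ_1 … λ_i} ∩ 𝓕^{c_{i+1} … c_n}`. For `i = n` this
says that `B` is a Gelfand-Tsetlin basis of `𝓕`. The elements are enumerated by `k`-sets in an
arbitrary order, and each may be scaled arbitrarily. -/
def IsIntermediateBasis (n k i : ℕ) (B : Module.Basis (KSet n k) ℂ (FunSpace n k)) : Prop :=
  ∀ a, ∃ (W : ℕ → Submodule ℂ (FunSpace n k)) (c : Fin n → Bool),
    (∀ j ∈ Finset.Icc 1 i, IsIsotypicSubspace n k j (W j)) ∧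
      B a ∈ chainSubspace n k i W ⊓ wordSubspace n k i c

/-- The change of basis matrix `[B]_{B'}`, whose columns are the elements of `B` written in
the basis `B'`. -/
def changeOfBasis {n k : ℕ} (B B' : Module.Basis (KSet n k) ℂ (FunSpace n k)) :
    Matrix (KSet n k) (KSet n k) ℂ :=
  B'.toMatrix B

/-! ### The computational model

Straight-line programs over `ℂ`. One operation is a complex multiplication together with an
addition; reading, copying and reordering values is free. -/

/-- What an operation can read: the constants `0` and `1`, an input variable, or the result of the
operation number `t` of the program (counted from `0`). -/
inductive Operand (V : Type) : Type
  | zero : Operand V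
  | one : Operand V
  | var (v : V) : Operand V
  | reg (t : ℕ) : Operand V

/-- The value of an operand, for given input values and given results of the operations performed
so far. A result that is not there yet reads as `0`. -/
def Operand.val {V : Type} (env : V → ℂ) (regs : List ℂ) : Operand V → ℂ
  | .zero => 0
  | .one => 1
  | .var v => env v
  | .reg t => regs.getD t 0

/-- A single operation `a + b * c`. -/
structure Operation (V : Type) : Type where
  a : Operand V
  b : Operand V
  c : Operand V

/-- The list of results of a sequence of operations, performed in order. -/
def run {V : Type} (env : V → ℂ) (code : List (Operation V)) : List ℂ :=
  code.foldl
    (fun regs op => regs ++ [op.a.val env regs + op.b.val env regs * op.c.val env regs]) []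

/-- A program with input variables `V` and outputs indexed by `O`: a sequence of operations, and
for each output the place where it is found. -/
structure Program (V O : Type) : Type where
  code : List (Operation V)
  out : O → Operand V

/-- The number of operations that a program performs. -/
def Program.cost {V O : Type} (P : Program V O) : ℕ := P.code.length

/-- The output of a program on given input values. -/
def Program.eval {V O : Type} (P : Program V O) (env : V → ℂ) : O → ℂ :=
  fun o => (P.out o).val env (run env P.code)

/-- The input variables of the transform: the entries of the matrices `[B_{i-1}]_{B_i}` for
`i = 2, …, n`, and the coordinates of the column vector `[f]_{B_0}`. -/
inductive InputVar (n k : ℕ) : Type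
  | entry (i : Set.Icc 2 n) (a b : KSet n k) : InputVar n k
  | coord (x : KSet n k) : InputVar n k

/-- The values of the input variables. -/
def inputs {n k : ℕ} (B : ℕ → Module.Basis (KSet n k) ℂ (FunSpace n k)) (f : FunSpace n k) :
    InputVar n k → ℂ
  | .entry i a b => changeOfBasis (B ((i : ℕ) - 1)) (B (i : ℕ)) a b
  | .coord x => (B 0).repr f x

end JohnsonFFT

end

namespace JohnsonFFT

/-! Isotypic components enter through one central element only. The sum of the transpositions of the
first `j` places is central in the group algebra of `S_j`, so by Schur's lemma it is a scalar on
each isotypic component. A vector of an `i`-th intermediate basis is thus a joint eigenvector of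
these sums for `j ≤ i`, with prescribed letters after the first `i` places (`jointSpace`).

Such a joint eigenspace is at most a line (`finrank_jointSpace_le_one`). By induction on the level,
it suffices that restriction to one of the two letters in the last free place is injective. If
neither were, there would be nonzero `u`, living on sets that contain this place, and `w`, living on
sets that avoid it, both eigenfunctions of the sum of transpositions joining the place to the
earlier ones. Read where the function itself vanishes, the eigenvalue equation says that a raising
operator kills `u` (with the place deleted) and a lowering operator kills `w`. By the sl₂
commutation relation, raising is injective below the middle level and lowering above it, and the
levels `l` of `u` and `l + 1` of `w` cannot both escape.

A vector of `B_i` involves only those vectors of `B_{i+1}` that share its first `i` eigenvalues and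
its letters after the first `i + 1` places. They lie in a sum of two such lines, one for each letter
in the remaining place, so there are at most two of them (`ncard_support_repr_le_two`). Each factor
then costs one operation per entry of its support (`exists_code_sum`). -/

/-! ### Straight-line programs -/

/-- The operand reads only results of the first `m` operations. -/
def Operand.IsBelow {V : Type} (m : ℕ) : Operand V → Prop
  | .reg t => t < m
  | _ => True

theorem Operand.IsBelow.mono {V : Type} {m m' : ℕ} (h : m ≤ m') {o : Operand V}
    (ho : o.IsBelow m) : o.IsBelow m' := by
  cases o <;> simp_all [Operand.IsBelow]; omega

/-- The bound on the operand matters: a register not yet written reads as `0`, and this changes once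
it is filled. -/
theorem Operand.val_append {V : Type} (env : V → ℂ) {regs : List ℂ} (l : List ℂ) {o : Operand V}
    (ho : o.IsBelow regs.length) : o.val env (regs ++ l) = o.val env regs := by
  cases o <;> simp_all [Operand.IsBelow, Operand.val, List.getElem?_append]

theorem run_concat {V : Type} (env : V → ℂ) (code : List (Operation V)) (op : Operation V) :
    run env (code ++ [op]) = run env code ++
      [op.a.val env (run env code) + op.b.val env (run env code) * op.c.val env (run env code)] := by
  simp [run, List.foldl_append]

@[simp]
theorem length_run {V : Type} (env : V → ℂ) (code : List (Operation V)) :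
    (run env code).length = code.length := by
  induction code using List.reverseRecOn with
  | nil => simp [run]
  | append_singleton l op ih => simp [run_concat, ih]

theorem exists_run_append {V : Type} (env : V → ℂ) (code code' : List (Operation V)) :
    ∃ l, run env (code ++ code') = run env code ++ l := by
  induction code' using List.reverseRecOn with
  | nil => exact ⟨[], by simp⟩
  | append_singleton l op ih =>
    obtain ⟨r, hr⟩ := ih
    rw [← List.append_assoc, run_concat, hr, List.append_assoc]
    exact ⟨_, rfl⟩

theorem Operand.val_run_append {V : Type} (env : V → ℂ) {code : List (Operation V)}
    (code' : List (Operation V)) {o : Operand V} (ho : o.IsBelow code.length) :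
    o.val env (run env (code ++ code')) = o.val env (run env code) := by
  obtain ⟨l, hl⟩ := exists_run_append env code code'
  rw [hl, Operand.val_append]
  simpa using ho

/-- A sparse matrix whose entries are inputs is applied to a computed vector with one operation for
each entry of a set `S` that contains its support. -/
theorem exists_code_sum {V K : Type} [Fintype K] [DecidableEq K] (m : K → K → V)
    (code : List (Operation V)) (loc : K → Operand V) (hloc : ∀ x, (loc x).IsBelow code.length)
    (S : Finset (K × K)) :
    ∃ (stage : List (Operation V)) (loc' : K → Operand V),
      stage.length = S.card ∧ (∀ x, (loc' x).IsBelow (code ++ stage).length) ∧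
      ∀ env : V → ℂ, ∀ x, (loc' x).val env (run env (code ++ stage)) =
        ∑ y, if (x, y) ∈ S then env (m x y) * (loc y).val env (run env code) else 0 := by
  induction S using Finset.induction_on with
  | empty => exact ⟨[], fun _ => .zero, by simp, by simp [Operand.IsBelow], by simp [Operand.val]⟩
  | insert p S hp ih =>
    obtain ⟨stage, loc', hlen, hbelow, hval⟩ := ih
    obtain ⟨a, b⟩ := p
    -- One more operation adds the new term to the running total of row `a`, whose location moves to
    -- the fresh register.
    refine ⟨stage ++ [⟨loc' a, .var (m a b), loc b⟩],
      Function.update loc' a (.reg (code ++ stage).length), ?_, ?_, ?_⟩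
    · simp [hlen, Finset.card_insert_of_notMem hp]
    · intro x
      by_cases hx : x = a
      · subst hx
        simp [Operand.IsBelow]
      · rw [Function.update_of_ne hx]
        exact (hbelow x).mono (by simp)
    · intro env x
      have hlocb : (loc b).val env (run env (code ++ stage)) = (loc b).val env (run env code) :=
        Operand.val_run_append env stage (hloc b)
      by_cases hx : x = a
      · subst hx
        rw [Function.update_self, ← List.append_assoc, run_concat]
        have hreg (r : List ℂ) (z : ℂ) (t : ℕ) (ht : t = r.length) :
            (Operand.reg t : Operand V).val env (r ++ [z]) = z := by
          subst ht; simp [Operand.val]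
        rw [hreg _ _ _ (by simp), hval, hlocb]
        have hsplit : ∀ y, (if (x, y) ∈ insert (x, b) S then
              env (m x y) * (loc y).val env (run env code) else 0) =
            (if (x, y) ∈ S then env (m x y) * (loc y).val env (run env code) else 0) +
              if y = b then env (m x y) * (loc y).val env (run env code) else 0 := by
          intro y
          by_cases hy : y = b
          · subst hy; simp [hp]
          · simp [hy]
        rw [Finset.sum_congr rfl fun y _ => hsplit y, Finset.sum_add_distrib]
        simp [Operand.val]
      · rw [Function.update_of_ne hx, ← List.append_assoc,
          Operand.val_run_append env _ (hbelow x), hval]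
        simp [hx]

/-- A chain of sparse matrices, all of whose entries are inputs, is applied to an input vector stage
by stage. Stage `i` applies the matrix with the entries `m i`, supported in `S i`. -/
theorem exists_stages {V K : Type} [Fintype K] [DecidableEq K] (N c : ℕ) (m : ℕ → K → K → V)
    (S : ℕ → Finset (K × K)) (hS : ∀ i, 2 ≤ i → i ≤ N → (S i).card ≤ c) (loc₁ : K → Operand V)
    (hloc₁ : ∀ x, (loc₁ x).IsBelow 0) :
    ∃ (stage : ℕ → List (Operation V)) (loc : ℕ → K → Operand V), loc 1 = loc₁ ∧
      (∀ i, 2 ≤ i → i ≤ N → (stage i).length ≤ c) ∧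
      ∀ env : V → ℂ, ∀ i, 1 ≤ i → ∀ x,
        (loc (i + 1) x).val env (run env ((List.range' 2 i).flatMap stage)) =
          ∑ y, if (x, y) ∈ S (i + 1) then env (m (i + 1) x y) *
            (loc i y).val env (run env ((List.range' 2 (i - 1)).flatMap stage)) else 0 := by
  choose! st lc hlen hbelow hval using fun (i : ℕ) (code : List (Operation V))
    (loc : K → Operand V) (h : ∀ x, (loc x).IsBelow code.length) =>
      exists_code_sum (m i) code loc h (S i)
  -- `state j` holds the code of the stages `2, …, j + 1` and the places of their results. A stage
  -- depends on all code before it, since registers are numbered globally.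
  let state : ℕ → List (Operation V) × (K → Operand V) := fun j =>
    Nat.rec ([], loc₁) (fun j s => (s.1 ++ st (j + 2) s.1 s.2, lc (j + 2) s.1 s.2)) j
  have hsucc (j : ℕ) : state (j + 1) = ((state j).1 ++ st (j + 2) (state j).1 (state j).2,
      lc (j + 2) (state j).1 (state j).2) := rfl
  have hst (j : ℕ) : ∀ x, ((state j).2 x).IsBelow (state j).1.length := by
    induction j with
    | zero => exact hloc₁
    | succ j ih => rw [hsucc]; exact hbelow _ _ _ ih
  let stage : ℕ → List (Operation V) := fun i => st i (state (i - 2)).1 (state (i - 2)).2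
  have hcode (j : ℕ) : (List.range' 2 j).flatMap stage = (state j).1 := by
    induction j with
    | zero => rfl
    | succ j ih =>
      rw [List.range'_concat, List.flatMap_append, ih, hsucc]
      simp [stage, Nat.add_comm]
  refine ⟨stage, fun i => (state (i - 1)).2, rfl, fun i hi hiN => ?_, fun env i hi x => ?_⟩
  · exact (hlen i _ _ (hst (i - 2))).trans_le (hS i hi hiN)
  · obtain ⟨j, rfl⟩ : ∃ j, i = j + 1 := ⟨i - 1, by omega⟩
    rw [hcode, hcode]
    exact hval (j + 2) _ _ (hst j) env x


/-! ### Central elements and isotypic components -/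

/-- A central element of an algebra over `ℂ` acts by a scalar on each isotypic component of a
finite-dimensional module. -/
theorem exists_smul_eq_of_mem_isotypicComponents {R M : Type*} [Ring R] [Algebra ℂ R]
    [AddCommGroup M] [Module ℂ M] [Module R M] [IsScalarTower ℂ R M] [Module.Finite ℂ M]
    {z : R} (hz : ∀ r, r * z = z * r) {C : Submodule R M} (hC : C ∈ isotypicComponents R M) :
    ∃ θ : ℂ, ∀ v ∈ C, z • v = θ • v := by
  obtain ⟨S, hS, rfl⟩ := hC
  have : Module.Finite ℂ S :=
    inferInstanceAs (Module.Finite ℂ (S.restrictScalars ℂ))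
  let φ : Module.End R S :=
    { toFun := fun v => z • v
      map_add' := smul_add z
      map_smul' := fun r v => by simp [← mul_smul, hz] }
  obtain ⟨θ, hθ⟩ := (IsSimpleModule.algebraMap_end_bijective_of_isAlgClosed ℂ).2 φ
  have hS' (s : S) : z • s = θ • s := (LinearMap.congr_fun hθ s).symm
  -- Centrality of `z` makes this eigenspace an `R`-submodule. It contains every simple copy of `S`,
  -- hence their supremum.
  let N : Submodule R M :=
    { carrier := {v | z • v = θ • v}
      add_mem' := fun {v w} hv hw => by
        rw [Set.mem_ofPred_eq] at *
        rw [smul_add, smul_add, hv, hw]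
      zero_mem' := by simp
      smul_mem' := fun r v hv => by
        rw [Set.mem_ofPred_eq] at *
        rw [← mul_smul, ← hz, mul_smul, hv, ← algebraMap_smul R θ v, ← mul_smul,
          ← Algebra.commutes, mul_smul, algebraMap_smul] }
  suffices isotypicComponent R M S ≤ N from ⟨θ, fun v hv => this hv⟩
  refine sSup_le ?_
  rintro p ⟨e⟩ v hv
  have h : e (z • ⟨v, hv⟩) = e (θ • ⟨v, hv⟩) := by
    rw [map_smul, hS' (e ⟨v, hv⟩), ← algebraMap_smul R θ (⟨v, hv⟩ : p), map_smul, algebraMap_smul]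
  exact congrArg Subtype.val (e.injective h)

/-- The sum of the operators of all transpositions of two of the first `j` places (ordered pairs,
with repetitions). -/
def swapSum (n k j : ℕ) : Module.End ℂ (FunSpace n k) :=
  ∑ p : {a : Fin n // (a : ℕ) < j} × {a : Fin n // (a : ℕ) < j},
    funRep n k (Equiv.swap p.1.1 p.2.1)

theorem swap_mem_initialPerm {n j : ℕ} {a b : Fin n} (ha : (a : ℕ) < j) (hb : (b : ℕ) < j) :
    Equiv.swap a b ∈ initialPerm n j := by
  intro m hm
  apply Equiv.swap_apply_of_ne_of_ne <;> rintro rfl <;> omega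

theorem initialPerm_apply_lt {n j : ℕ} {σ : Equiv.Perm (Fin n)} (hσ : σ ∈ initialPerm n j)
    {a : Fin n} (ha : (a : ℕ) < j) : (σ a : ℕ) < j := by
  by_contra! h
  have := σ.injective (hσ (σ a) h)
  omega

/-- An element of `S_j` permutes the first `j` places. -/
def placePerm {n j : ℕ} (σ : initialPerm n j) : Equiv.Perm {a : Fin n // (a : ℕ) < j} where
  toFun a := ⟨σ.1 a.1, initialPerm_apply_lt σ.2 a.2⟩
  invFun a := ⟨σ.1⁻¹ a.1, initialPerm_apply_lt (inv_mem σ.2) a.2⟩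
  left_inv a := by simp
  right_inv a := by simp

theorem IsIsotypicSubspace.exists_le_eigenspace {n k j : ℕ} {W : Submodule ℂ (FunSpace n k)}
    (hW : IsIsotypicSubspace n k j W) : ∃ θ : ℂ, W ≤ (swapSum n k j).eigenspace θ := by
  obtain ⟨C, hC, rfl⟩ := hW
  let z : MonoidAlgebra ℂ (initialPerm n j) :=
    ∑ p : {a : Fin n // (a : ℕ) < j} × {a : Fin n // (a : ℕ) < j},
      MonoidAlgebra.of ℂ _ ⟨Equiv.swap p.1.1 p.2.1, swap_mem_initialPerm p.1.2 p.2.2⟩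
  have hz : ∀ r, r * z = z * r := by
    intro r
    induction r using MonoidAlgebra.induction_on with
    | of σ =>
      simp only [z, Finset.mul_sum, Finset.sum_mul]
      -- Conjugation by `σ` permutes the pairs of places that index the sum.
      refine Fintype.sum_equiv ((placePerm σ).prodCongr (placePerm σ)) _ _ fun p => ?_
      rw [← map_mul, ← map_mul]
      congr 1
      ext1
      simp [placePerm, Equiv.mul_swap_eq_swap_mul]
    | add a b ha hb => rw [add_mul, mul_add, ha, hb]
    | smul c a ha => rw [smul_mul_assoc, mul_smul_comm, ha]
  obtain ⟨θ, hθ⟩ := exists_smul_eq_of_mem_isotypicComponents hz hC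
  refine ⟨θ, ?_⟩
  rintro _ ⟨v, hv, rfl⟩
  rw [Module.End.mem_eigenspace_iff]
  have h := congrArg (restrictedRep n k j).asModuleEquiv (hθ v hv)
  rw [Representation.asModuleEquiv_map_smul, map_smul] at h
  rw [LinearEquiv.coe_coe, ← h]
  simp [z, swapSum, restrictedRep, LinearMap.sum_apply]


/-! ### Raising and lowering operators on the Boolean lattice -/

section Boolean

variable {α : Type*} [DecidableEq α]

/-- On delta functions this sends the one at `y` to the one at `y ∪ {a}` if `a ∉ y`, and to zero
otherwise; `delPoint` is its adjoint. -/
def addPoint (a : α) (u : Finset α → ℂ) (x : Finset α) : ℂ := if a ∈ x then u (x.erase a) else 0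

def delPoint (a : α) (u : Finset α → ℂ) (x : Finset α) : ℂ := if a ∈ x then 0 else u (insert a x)

/-- The raising operator for the places in `A`. -/
def raise (A : Finset α) (u : Finset α → ℂ) (x : Finset α) : ℂ := ∑ a ∈ A, addPoint a u x

/-- The lowering operator for the places in `A`. -/
def lower (A : Finset α) (u : Finset α → ℂ) (x : Finset α) : ℂ := ∑ a ∈ A, delPoint a u x

theorem delPoint_addPoint_sub (a b : α) (u : Finset α → ℂ) (x : Finset α) :
    delPoint a (addPoint b u) x - addPoint b (delPoint a u) x =
      if a = b then (if a ∈ x then -u x else u x) else 0 := by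
  by_cases hab : a = b
  · subst hab
    by_cases hx : a ∈ x <;> simp [delPoint, addPoint, hx]
  · by_cases ha : a ∈ x <;> by_cases hb : b ∈ x <;>
      simp [delPoint, addPoint, ha, hb, hab, Ne.symm hab, Finset.erase_insert_of_ne hab]

/-- The sl₂ relation: operators at distinct places commute, and each single place contributes `+1`
outside `x` and `-1` inside. -/
theorem lower_raise (A : Finset α) (u : Finset α → ℂ) (x : Finset α) :
    lower A (raise A u) x = raise A (lower A u) x +
      (((A.filter (· ∉ x)).card : ℂ) - ((A.filter (· ∈ x)).card : ℂ)) * u x := by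
  have h1 : lower A (raise A u) x = ∑ a ∈ A, ∑ b ∈ A, delPoint a (addPoint b u) x := by
    refine Finset.sum_congr rfl fun a _ => ?_
    by_cases ha : a ∈ x <;> simp [delPoint, raise, ha]
  have h2 : raise A (lower A u) x = ∑ a ∈ A, ∑ b ∈ A, addPoint b (delPoint a u) x := by
    rw [Finset.sum_comm]
    refine Finset.sum_congr rfl fun a _ => ?_
    by_cases ha : a ∈ x <;> simp [addPoint, lower, ha]
  rw [← sub_eq_iff_eq_add', h1, h2]
  simp only [← Finset.sum_sub_distrib, delPoint_addPoint_sub]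
  have h3 : ∀ a ∈ A, (∑ b ∈ A, if a = b then (if a ∈ x then -u x else u x) else 0) =
      (if a ∉ x then u x else 0) - (if a ∈ x then u x else 0) := by
    intro a ha
    by_cases hx : a ∈ x <;> simp [ha, hx]
  rw [Finset.sum_congr rfl h3, Finset.sum_sub_distrib, ← Finset.sum_filter, ← Finset.sum_filter]
  simp [sub_mul]

theorem lower_conj (A : Finset α) (u : Finset α → ℂ) (x : Finset α) :
    lower A (fun y => star (u y)) x = star (lower A u x) := by
  simp [lower, delPoint, apply_ite]

theorem raise_conj (A : Finset α) (u : Finset α → ℂ) (x : Finset α) :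
    raise A (fun y => star (u y)) x = star (raise A u x) := by
  simp [raise, addPoint]

variable [Fintype α]

theorem sum_addPoint_mul (a : α) (u v : Finset α → ℂ) :
    ∑ x, addPoint a u x * v x = ∑ x, u x * delPoint a v x := by
  simp only [addPoint, delPoint, ite_mul, mul_ite, zero_mul, mul_zero]
  rw [← Finset.sum_filter, ← Finset.sum_congr rfl fun x _ => ite_not (a ∈ x) (u x * v (insert a x)) 0,
    ← Finset.sum_filter]
  refine Finset.sum_nbij' (fun x => x.erase a) (fun x => insert a x) ?_ ?_ ?_ ?_ ?_ <;>
    simp +contextual [Finset.insert_erase]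

theorem sum_raise_mul (A : Finset α) (u v : Finset α → ℂ) :
    ∑ x, raise A u x * v x = ∑ x, u x * lower A v x := by
  simp only [raise, lower, Finset.sum_mul, Finset.mul_sum]
  rw [Finset.sum_comm, Finset.sum_comm (s := Finset.univ)]
  exact Finset.sum_congr rfl fun a _ => sum_addPoint_mul a u v

/-- Adjointness turns both squared norms into pairings of `u` with `lower A (raise A u)` and `raise
A (lower A u)`, which differ by the commutator. -/
theorem sum_normSq_raise (A : Finset α) (u : Finset α → ℂ) :
    ∑ x, Complex.normSq (raise A u x) = ∑ x, Complex.normSq (lower A u x) +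
      ∑ x, (((A.filter (· ∉ x)).card : ℝ) - ((A.filter (· ∈ x)).card : ℝ)) *
        Complex.normSq (u x) := by
  have h1 : ∑ x, raise A u x * star (raise A u x) = ∑ x, u x * star (lower A (raise A u) x) := by
    rw [sum_raise_mul A u fun x => star (raise A u x)]
    simp only [lower_conj]
  have h2 : ∑ x, lower A u x * star (lower A u x) = ∑ x, u x * star (raise A (lower A u) x) := by
    have := sum_raise_mul A (fun x => star (lower A u x)) u
    simp only [raise_conj] at this
    simp only [mul_comm (u _), this]
    exact Finset.sum_congr rfl fun x _ => mul_comm _ _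
  have h3 : ((∑ x, Complex.normSq (raise A u x) : ℝ) : ℂ) =
      ((∑ x, Complex.normSq (lower A u x) + ∑ x, (((A.filter (· ∉ x)).card : ℝ) -
        ((A.filter (· ∈ x)).card : ℝ)) * Complex.normSq (u x) : ℝ) : ℂ) := by
    push_cast
    simp only [← Complex.mul_conj]
    change ∑ x, raise A u x * star (raise A u x) = ∑ x, lower A u x * star (lower A u x) +
      ∑ x, _ * (u x * star (u x))
    rw [h1, h2, ← Finset.sum_add_distrib]
    refine Finset.sum_congr rfl fun x _ => ?_
    rw [lower_raise]
    simp
    ring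
  exact_mod_cast h3

/-- In the norm identity both terms on the right are nonnegative, so they vanish; the weight is
positive on the support of `u`. -/
theorem eq_zero_of_raise_eq_zero {A : Finset α} {u : Finset α → ℂ} (h : ∀ x, raise A u x = 0)
    (hu : ∀ x, u x ≠ 0 → (A.filter (· ∈ x)).card < (A.filter (· ∉ x)).card) : u = 0 := by
  have hs := sum_normSq_raise A u
  simp only [h, map_zero, Finset.sum_const_zero] at hs
  have hterm : ∀ x ∈ Finset.univ, 0 ≤ (((A.filter (· ∉ x)).card : ℝ) -
      ((A.filter (· ∈ x)).card : ℝ)) * Complex.normSq (u x) := by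
    intro x _
    by_cases hx : u x = 0
    · simp [hx]
    · exact mul_nonneg (sub_nonneg.2 (by exact_mod_cast (hu x hx).le)) (Complex.normSq_nonneg _)
  have h1 : 0 ≤ ∑ x, Complex.normSq (lower A u x) :=
    Finset.sum_nonneg fun x _ => Complex.normSq_nonneg _
  have h0 := (Finset.sum_eq_zero_iff_of_nonneg hterm).1
    (le_antisymm (by linarith) (Finset.sum_nonneg hterm))
  funext x
  by_contra hx
  have := h0 x (Finset.mem_univ x)
  rw [mul_eq_zero, sub_eq_zero, Complex.normSq_eq_zero] at this
  rcases this with h | h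
  · exact (hu x hx).ne' (by exact_mod_cast h)
  · exact hx h

theorem eq_zero_of_lower_eq_zero {A : Finset α} {u : Finset α → ℂ} (h : ∀ x, lower A u x = 0)
    (hu : ∀ x, u x ≠ 0 → (A.filter (· ∉ x)).card < (A.filter (· ∈ x)).card) : u = 0 := by
  have hs := sum_normSq_raise A u
  simp only [h, map_zero, Finset.sum_const_zero, zero_add] at hs
  have hterm : ∀ x ∈ Finset.univ, (((A.filter (· ∉ x)).card : ℝ) -
      ((A.filter (· ∈ x)).card : ℝ)) * Complex.normSq (u x) ≤ 0 := by
    intro x _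
    by_cases hx : u x = 0
    · simp [hx]
    · exact mul_nonpos_of_nonpos_of_nonneg (sub_nonpos.2 (by exact_mod_cast (hu x hx).le))
        (Complex.normSq_nonneg _)
  have h1 : 0 ≤ ∑ x, Complex.normSq (raise A u x) :=
    Finset.sum_nonneg fun x _ => Complex.normSq_nonneg _
  have h0 := (Finset.sum_eq_zero_iff_of_nonpos hterm).1
    (le_antisymm (Finset.sum_nonpos hterm) (by linarith))
  funext x
  by_contra hx
  have := h0 x (Finset.mem_univ x)
  rw [mul_eq_zero, sub_eq_zero, Complex.normSq_eq_zero] at this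
  rcases this with h | h
  · exact (hu x hx).ne (by exact_mod_cast h)
  · exact hx h

end Boolean

/-! ### Eigenfunctions of a Jucys-Murphy element -/

/-- Extension by zero of a function on `k`-sets to all subsets. -/
def extendZero {n k : ℕ} (f : FunSpace n k) (x : Finset (Fin n)) : ℂ :=
  if h : x.card = k then f ⟨x, h⟩ else 0

@[simp]
theorem extendZero_coe {n k : ℕ} (f : FunSpace n k) (x : KSet n k) :
    extendZero f (x : Finset (Fin n)) = f x :=
  dif_pos x.2

theorem exists_of_extendZero_ne_zero {n k : ℕ} {f : FunSpace n k} {x : Finset (Fin n)}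
    (h : extendZero f x ≠ 0) : ∃ y : KSet n k, (y : Finset (Fin n)) = x ∧ f y ≠ 0 := by
  by_cases hx : x.card = k
  · exact ⟨⟨x, hx⟩, rfl, by simpa [extendZero, hx] using h⟩
  · simp [extendZero, hx] at h

open scoped Pointwise in
theorem sum_extendZero_swap_smul {n k : ℕ} {i : Fin n} {f : FunSpace n k} {μ : ℂ}
    (hf : ∀ x, ∑ a ∈ Finset.Iio i, f (Equiv.swap a i • x) = μ * f x) (x : Finset (Fin n)) :
    ∑ a ∈ Finset.Iio i, extendZero f (Equiv.swap a i • x) = μ * extendZero f x := by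
  by_cases hx : x.card = k
  · have := hf ⟨x, hx⟩
    simp only [← extendZero_coe] at this
    exact this
  · simp [extendZero, hx]

open scoped Pointwise in
theorem swap_smul_of_mem_of_notMem {α : Type*} [DecidableEq α] {a i : α} {x : Finset α}
    (ha : a ∈ x) (hi : i ∉ x) :
    Equiv.swap a i • x = insert i (x.erase a) := by
  ext b
  rw [← Finset.inv_smul_mem_iff, Equiv.swap_inv, Equiv.Perm.smul_def, Finset.mem_insert,
    Finset.mem_erase]
  by_cases hb : b = a
  · subst hb; simp [hi]; rintro rfl; exact hi ha
  · by_cases hb' : b = i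
    · subst hb'; simp [ha]
    · simp [Equiv.swap_apply_of_ne_of_ne hb hb', hb, hb']

open scoped Pointwise in
theorem swap_smul_of_mem_iff {α : Type*} [DecidableEq α] {a i : α} {x : Finset α}
    (h : a ∈ x ↔ i ∈ x) : Equiv.swap a i • x = x := by
  ext b
  rw [← Finset.inv_smul_mem_iff, Equiv.swap_inv, Equiv.Perm.smul_def]
  by_cases hb : b = a
  · subst hb; simp [h]
  · by_cases hb' : b = i
    · subst hb'; simp [h]
    · simp [Equiv.swap_apply_of_ne_of_ne hb hb']

open scoped Pointwise in
/-- Let `X` be the sum of the transpositions of the place `i` with an earlier place. An eigenfunction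
of `X` on the `k`-sets that contain `i` and an eigenfunction of `X` on the `k`-sets that do not
contain `i` are not both nonzero. -/
theorem eq_zero_or_eq_zero_of_sum_swap_smul {n k l : ℕ} {i : Fin n} {u w : FunSpace n k} {μ ν : ℂ}
    (hu : ∀ x, u x ≠ 0 → i ∈ (x : Finset (Fin n)) ∧
      ((Finset.Iio i).filter (· ∈ (x : Finset (Fin n)))).card = l)
    (hw : ∀ x, w x ≠ 0 → i ∉ (x : Finset (Fin n)) ∧
      ((Finset.Iio i).filter (· ∈ (x : Finset (Fin n)))).card = l + 1)
    (hXu : ∀ x, ∑ a ∈ Finset.Iio i, u (Equiv.swap a i • x) = μ * u x)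
    (hXw : ∀ x, ∑ a ∈ Finset.Iio i, w (Equiv.swap a i • x) = ν * w x) : u = 0 ∨ w = 0 := by
  have hcard (x : Finset (Fin n)) := Finset.card_filter_add_card_filter_not
    (s := Finset.Iio i) (· ∈ x)
  rw [Fin.card_Iio] at hcard
  have hu' : ∀ x, i ∉ x → extendZero u x = 0 := by
    intro x hx
    by_contra h
    obtain ⟨y, rfl, hy⟩ := exists_of_extendZero_ne_zero h
    exact hx (hu y hy).1
  have hw' : ∀ x, i ∈ x → extendZero w x = 0 := by
    intro x hx
    by_contra h
    obtain ⟨y, rfl, hy⟩ := exists_of_extendZero_ne_zero h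
    exact (hw y hy).1 hx
  -- There are `i` earlier places. Raising is injective at level `l` if `l < i - l`, lowering at
  -- level `l + 1` if `i - (l + 1) < l + 1`; one of these always holds.
  by_cases hl : 2 * l < (i : ℕ)
  · left
    have hzero : delPoint i (extendZero u) = 0 := by
      refine eq_zero_of_raise_eq_zero (A := Finset.Iio i) (fun x => ?_) (fun x hx => ?_)
      · by_cases hi : i ∈ x
        · refine Finset.sum_eq_zero fun a ha => ?_
          have : i ≠ a := (Finset.mem_Iio.1 ha).ne'
          simp [addPoint, delPoint, hi, this]
        -- At a set without `i` the right side vanishes, whatever `μ` is. Only `a ∈ x` contribute on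
        -- the left, and they give the raising operator.
        · have := sum_extendZero_swap_smul hXu x
          rw [hu' x hi, mul_zero] at this
          rw [← this]
          refine Finset.sum_congr rfl fun a ha => ?_
          by_cases hax : a ∈ x
          · simp [addPoint, delPoint, hax, hi, swap_smul_of_mem_of_notMem hax hi]
          · simp [addPoint, hax, swap_smul_of_mem_iff (iff_of_false hax hi), hu' x hi]
      · by_cases hi : i ∈ x
        · simp [delPoint, hi] at hx
        · simp only [delPoint, hi, if_false] at hx
          obtain ⟨y, hy, hy'⟩ := exists_of_extendZero_ne_zero hx
          have h1 := (hu y hy').2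
          have h2 : (Finset.Iio i).filter (· ∈ (y : Finset (Fin n))) =
              (Finset.Iio i).filter (· ∈ x) := by
            refine Finset.filter_congr fun a ha => ?_
            rw [hy, Finset.mem_insert, or_iff_right (Finset.mem_Iio.1 ha).ne]
          rw [h2] at h1
          have := hcard x
          omega
    funext x
    by_contra hx
    have hi := (hu x hx).1
    have := congrFun hzero ((x : Finset (Fin n)).erase i)
    simp [delPoint, Finset.insert_erase hi] at this
    exact hx this
  · right
    have hzero : extendZero w = 0 := by
      refine eq_zero_of_lower_eq_zero (A := Finset.Iio i) (fun x => ?_) (fun x hx => ?_)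
      · by_cases hi : i ∈ x
        · refine Finset.sum_eq_zero fun a ha => ?_
          simp [delPoint, hw' (insert a x) (Finset.mem_insert_of_mem hi)]
        -- Dually, the equation is read at a set containing `i`, where `w` vanishes.
        · have := sum_extendZero_swap_smul hXw (insert i x)
          rw [hw' _ (Finset.mem_insert_self i x), mul_zero] at this
          rw [← this]
          refine Finset.sum_congr rfl fun a ha => ?_
          have hai : a ≠ i := (Finset.mem_Iio.1 ha).ne
          by_cases hax : a ∈ x
          · rw [swap_smul_of_mem_iff (iff_of_true (Finset.mem_insert_of_mem hax)
              (Finset.mem_insert_self i x)), hw' _ (Finset.mem_insert_self i x)]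
            simp [delPoint, hax]
          · rw [Equiv.swap_comm, swap_smul_of_mem_of_notMem (Finset.mem_insert_self i x)
              (by simp [hai, hax]), Finset.erase_insert hi]
            simp [delPoint, hax]
      · obtain ⟨y, rfl, hy⟩ := exists_of_extendZero_ne_zero hx
        have h1 := (hw y hy).2
        have := hcard (y : Finset (Fin n))
        omega
    funext x
    simpa using congrFun hzero (x : Finset (Fin n))


/-! ### Joint eigenspaces -/

theorem mem_smul_iff {n k : ℕ} (σ : Equiv.Perm (Fin n)) (x : KSet n k) (a : Fin n) :
    a ∈ ((σ • x : KSet n k) : Finset (Fin n)) ↔ σ⁻¹ a ∈ (x : Finset (Fin n)) := by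
  rw [Set.powersetCard.coe_smul, ← Finset.inv_smul_mem_iff]
  rfl

theorem funRep_apply {n k : ℕ} (σ : Equiv.Perm (Fin n)) (f : FunSpace n k) (x : KSet n k) :
    funRep n k σ f x = f (σ⁻¹ • x) := rfl

theorem swapSum_apply {n k : ℕ} (j : ℕ) (f : FunSpace n k) (x : KSet n k) :
    swapSum n k j f x = ∑ p : {a : Fin n // (a : ℕ) < j} × {a : Fin n // (a : ℕ) < j},
      f (Equiv.swap p.1.1 p.2.1 • x) := by
  simp [swapSum, LinearMap.sum_apply, Finset.sum_apply, funRep_apply]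

theorem swapSum_zero (n k : ℕ) : swapSum n k 0 = 0 := by
  refine LinearMap.ext fun f => funext fun x => ?_
  rw [swapSum_apply]
  exact Finset.sum_eq_zero fun p _ => absurd p.1.2 (Nat.not_lt_zero _)

/-- The projection that keeps the values at the `k`-sets containing `i` (if `b` is true), or at
those not containing it (if `b` is false). -/
def letterProj (n k : ℕ) (i : Fin n) (b : Bool) : Module.End ℂ (FunSpace n k) where
  toFun f x := if i ∈ (x : Finset (Fin n)) ↔ b = true then f x else 0
  map_add' f g := by ext x; by_cases h : i ∈ (x : Finset (Fin n)) ↔ b = true <;> simp [h]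
  map_smul' c f := by ext x; by_cases h : i ∈ (x : Finset (Fin n)) ↔ b = true <;> simp [h]

theorem letterProj_apply {n k : ℕ} (i : Fin n) (b : Bool) (f : FunSpace n k) (x : KSet n k) :
    letterProj n k i b f x = if i ∈ (x : Finset (Fin n)) ↔ b = true then f x else 0 := rfl

theorem letterProj_add_letterProj {n k : ℕ} (i : Fin n) (f : FunSpace n k) :
    letterProj n k i true f + letterProj n k i false f = f := by
  ext x
  by_cases h : i ∈ (x : Finset (Fin n)) <;> simp [letterProj_apply, h]

/-- The transpositions involved fix the place `i`, so they preserve its letter. -/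
theorem swapSum_letterProj {n k j : ℕ} {i : Fin n} (hij : j ≤ i) (b : Bool) (f : FunSpace n k) :
    swapSum n k j (letterProj n k i b f) = letterProj n k i b (swapSum n k j f) := by
  ext x
  have h : ∀ p : {a : Fin n // (a : ℕ) < j} × {a : Fin n // (a : ℕ) < j},
      i ∈ ((Equiv.swap p.1.1 p.2.1 • x : KSet n k) : Finset (Fin n)) ↔
        i ∈ (x : Finset (Fin n)) := by
    rintro ⟨⟨a, ha⟩, ⟨b, hb⟩⟩
    rw [mem_smul_iff, Equiv.swap_inv, Equiv.swap_apply_of_ne_of_ne] <;> rintro rfl <;> omega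
  rw [letterProj_apply, swapSum_apply, swapSum_apply]
  simp only [letterProj_apply, h]
  split_ifs <;> simp

/-- The functions that are eigenvectors of `swapSum j` with eigenvalue `θ j` for `j ≤ i`, and whose
support consists of `k`-sets with the letters `c` in the places after the first `m`. -/
def jointSpace (n k i m : ℕ) (θ : ℕ → ℂ) (c : Fin n → Bool) : Submodule ℂ (FunSpace n k) where
  carrier := {f | (∀ j ≤ i, swapSum n k j f = θ j • f) ∧
    ∀ j : Fin n, m ≤ j → ∀ x, f x ≠ 0 → (j ∈ (x : Finset (Fin n)) ↔ c j = true)}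
  add_mem' := by
    rintro f g ⟨hf, hf'⟩ ⟨hg, hg'⟩
    refine ⟨fun j hj => by rw [map_add, smul_add, hf j hj, hg j hj], fun j hj x hx => ?_⟩
    by_cases h : f x = 0
    · exact hg' j hj x (by simpa [h] using hx)
    · exact hf' j hj x h
  zero_mem' := by simp
  smul_mem' := by
    rintro r f ⟨hf, hf'⟩
    refine ⟨fun j hj => by rw [map_smul, hf j hj, smul_comm], fun j hj x hx => ?_⟩
    exact hf' j hj x (right_ne_zero_of_mul hx)

theorem letterProj_mem_jointSpace {n k : ℕ} {i : Fin n} {θ : ℕ → ℂ} {c : Fin n → Bool} (b : Bool)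
    {f : FunSpace n k} (hf : f ∈ jointSpace n k i (i + 1) θ c) :
    letterProj n k i b f ∈ jointSpace n k i i θ (Function.update c i b) := by
  refine ⟨fun j hj => ?_, fun j hj x hx => ?_⟩
  · rw [swapSum_letterProj hj, hf.1 j hj, map_smul]
  · rw [letterProj_apply] at hx
    by_cases h : i ∈ (x : Finset (Fin n)) ↔ b = true
    · by_cases hji : j = i
      · subst hji; simpa using h
      · rw [if_pos h] at hx
        rw [Function.update_of_ne hji]
        exact hf.2 j (by have := Fin.val_ne_of_ne hji; omega) x hx
    · simp [h] at hx

/-- The number of elements before the place `i` of a `k`-set with prescribed letters from the place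
`i` on. -/
theorem card_filter_add_card_filter_of_mem_jointSpace {n k : ℕ} {m : ℕ} {i : Fin n} {θ : ℕ → ℂ}
    {c : Fin n → Bool} {f : FunSpace n k} (hf : f ∈ jointSpace n k m i θ c) {x : KSet n k}
    (hx : f x ≠ 0) : ((Finset.Iio i).filter (· ∈ (x : Finset (Fin n)))).card +
      ((Finset.Ici i).filter (c · = true)).card = k := by
  have h : (Finset.Ici i).filter (c · = true) =
      (Finset.Ici i).filter (· ∈ (x : Finset (Fin n))) :=
    Finset.filter_congr fun j hj => (hf.2 j (Fin.le_def.1 (Finset.mem_Ici.1 hj)) x hx).symm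
  rw [h, ← Finset.card_union_of_disjoint, ← Finset.filter_union]
  · conv_rhs => rw [← Set.powersetCard.card_eq x]
    congr 1
    ext a
    simp [lt_or_ge]
  · refine Finset.disjoint_filter_filter ?_
    rw [Finset.disjoint_left]
    intro a ha hb
    exact absurd (Finset.mem_Iio.1 ha) (not_lt.2 (Finset.mem_Ici.1 hb))

/-- The new ordered pairs are `(a, i)` and `(i, a)`, whence the factor 2, and `(i, i)`, which acts
as the identity. Two consecutive eigenvalues therefore determine that of the Jucys-Murphy sum. -/
theorem swapSum_succ_apply {n k : ℕ} (i : Fin n) (f : FunSpace n k) (x : KSet n k) :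
    swapSum n k (i + 1) f x =
      swapSum n k i f x + 2 * ∑ a ∈ Finset.Iio i, f (Equiv.swap a i • x) + f x := by
  have key (j : ℕ) : swapSum n k j f x = ∑ a ∈ Finset.univ.filter fun a : Fin n => (a : ℕ) < j,
      ∑ b ∈ Finset.univ.filter fun b : Fin n => (b : ℕ) < j, f (Equiv.swap a b • x) := by
    have hmem (a : Fin n) : a ∈ Finset.univ.filter (fun a : Fin n => (a : ℕ) < j) ↔ (a : ℕ) < j := by
      simp
    rw [swapSum_apply, Fintype.sum_prod_type, Finset.sum_subtype _ hmem]
    exact Finset.sum_congr rfl fun a _ =>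
      (Finset.sum_subtype _ hmem fun b => f (Equiv.swap a.1 b • x)).symm
  have h1 : (Finset.univ.filter fun a : Fin n => (a : ℕ) < i) = Finset.Iio i := by
    ext a; simp
  have h2 : (Finset.univ.filter fun a : Fin n => (a : ℕ) < i + 1) = insert i (Finset.Iio i) := by
    ext a; simp
  rw [key, key, h1, h2]
  simp only [Finset.sum_insert (Finset.notMem_Iio_self), Finset.sum_add_distrib]
  simp only [Equiv.swap_comm i, Equiv.swap_self]
  have : (Equiv.refl (Fin n)) • x = x := one_smul _ x
  rw [this]
  ring

theorem sum_swap_smul_of_mem_jointSpace {n k : ℕ} {i : Fin n} {m : ℕ} {θ : ℕ → ℂ}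
    {c : Fin n → Bool} {f : FunSpace n k} (hf : f ∈ jointSpace n k (i + 1) m θ c) (x : KSet n k) :
    ∑ a ∈ Finset.Iio i, f (Equiv.swap a i • x) = (θ (i + 1) - θ i - 1) / 2 * f x := by
  have h := swapSum_succ_apply i f x
  rw [hf.1 _ le_rfl, hf.1 i (Nat.le_succ _)] at h
  simp only [Pi.smul_apply, smul_eq_mul] at h
  linear_combination -h / 2

theorem jointSpace_mono {n k i i' m m' : ℕ} (hi : i' ≤ i) (hm : m ≤ m') (θ : ℕ → ℂ)
    (c : Fin n → Bool) : jointSpace n k i m θ c ≤ jointSpace n k i' m' θ c :=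
  fun _ hf => ⟨fun j hj => hf.1 j (hj.trans hi), fun j hj => hf.2 j (hm.trans hj)⟩

/-- The restriction to one of the two letters in the place `i` is injective on a joint eigenspace
at the level `i + 1`. -/
theorem exists_letterProj_injOn {n k : ℕ} (i : Fin n) (θ : ℕ → ℂ) (c : Fin n → Bool) :
    ∃ b, ∀ f ∈ jointSpace n k (i + 1) (i + 1) θ c, letterProj n k i b f = 0 → f = 0 := by
  by_contra! h
  obtain ⟨u, hu, hu0, hune⟩ := h false
  obtain ⟨w, hw, hw0, hwne⟩ := h true
  have hu1 : letterProj n k i true u = u := by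
    conv_rhs => rw [← letterProj_add_letterProj i u, hu0, add_zero]
  have hw1 : letterProj n k i false w = w := by
    conv_rhs => rw [← letterProj_add_letterProj i w, hw0, zero_add]
  have hu2 := letterProj_mem_jointSpace true (jointSpace_mono (Nat.le_succ i) le_rfl θ c hu)
  have hw2 := letterProj_mem_jointSpace false (jointSpace_mono (Nat.le_succ i) le_rfl θ c hw)
  rw [hu1] at hu2
  rw [hw1] at hw2
  -- With `i` in the set, one more element is used from the place `i` on, so one fewer lies before
  -- it: hence the levels `l` and `l + 1`.
  have hcard : ((Finset.Ici i).filter (Function.update c i true · = true)).card =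
      ((Finset.Ici i).filter (Function.update c i false · = true)).card + 1 := by
    rw [← Finset.card_insert_of_notMem (a := i) (by simp)]
    congr 1
    ext a
    by_cases ha : a = i
    · subst ha; simp
    · simp [ha]
  obtain ⟨x₀, hx₀⟩ := Function.ne_iff.1 hune
  have hc₀ := card_filter_add_card_filter_of_mem_jointSpace hu2 hx₀
  have hu3 : ∀ x, u x ≠ 0 → i ∈ (x : Finset (Fin n)) ∧
      ((Finset.Iio i).filter (· ∈ (x : Finset (Fin n)))).card =
        ((Finset.Iio i).filter (· ∈ (x₀ : Finset (Fin n)))).card := by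
    intro x hx
    have := card_filter_add_card_filter_of_mem_jointSpace hu2 hx
    exact ⟨by simpa using hu2.2 i le_rfl x hx, by omega⟩
  have hw3 : ∀ x, w x ≠ 0 → i ∉ (x : Finset (Fin n)) ∧
      ((Finset.Iio i).filter (· ∈ (x : Finset (Fin n)))).card =
        ((Finset.Iio i).filter (· ∈ (x₀ : Finset (Fin n)))).card + 1 := by
    intro x hx
    have := card_filter_add_card_filter_of_mem_jointSpace hw2 hx
    exact ⟨by simpa using hw2.2 i le_rfl x hx, by omega⟩
  exact (eq_zero_or_eq_zero_of_sum_swap_smul hu3 hw3 (sum_swap_smul_of_mem_jointSpace hu)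
    (sum_swap_smul_of_mem_jointSpace hw)).elim hune hwne

/-- The joint eigenspaces are at most one-dimensional. -/
theorem finrank_jointSpace_le_one {n k i : ℕ} (hi : i ≤ n) (θ : ℕ → ℂ) (c : Fin n → Bool) :
    Module.finrank ℂ (jointSpace n k i i θ c) ≤ 1 := by
  -- Projecting to a letter in the last free place prescribes a new value of `c` there.
  induction i generalizing c with
  | zero =>
    -- With all letters prescribed, at most one `k`-set can carry the support.
    by_cases hx : ∃ x : KSet n k, ∀ j, j ∈ (x : Finset (Fin n)) ↔ c j = true
    · obtain ⟨x, hx⟩ := hx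
      have hinj : Function.Injective ((LinearMap.proj x : FunSpace n k →ₗ[ℂ] ℂ).comp
          (jointSpace n k 0 0 θ c).subtype) := by
        rw [injective_iff_map_eq_zero]
        rintro ⟨f, hf⟩ h
        ext y
        by_contra hy
        have : y = x := by
          ext j
          exact (hf.2 j (Nat.zero_le _) y hy).trans (hx j).symm
        subst this
        exact hy h
      simpa using LinearMap.finrank_le_finrank_of_injective hinj
    · have : jointSpace n k 0 0 θ c = ⊥ := by
        rw [eq_bot_iff]
        intro f hf
        rw [Submodule.mem_bot]
        ext y
        by_contra hy
        exact hx ⟨y, fun j => hf.2 j (Nat.zero_le _) y hy⟩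
      rw [this, finrank_bot]
      exact zero_le_one
  | succ i ih =>
    obtain ⟨b, hb⟩ := exists_letterProj_injOn (k := k) ⟨i, hi⟩ θ c
    have hmem : ∀ f ∈ jointSpace n k (i + 1) (i + 1) θ c, letterProj n k ⟨i, hi⟩ b f ∈
        jointSpace n k i i θ (Function.update c ⟨i, hi⟩ b) := fun f hf =>
      letterProj_mem_jointSpace (i := ⟨i, hi⟩) b (jointSpace_mono (Nat.le_succ i) le_rfl θ c hf)
    refine le_trans (LinearMap.finrank_le_finrank_of_injective
      (f := (letterProj n k ⟨i, hi⟩ b).restrict hmem) ?_)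
      (ih (by omega) (Function.update c ⟨i, hi⟩ b))
    rw [injective_iff_map_eq_zero]
    rintro ⟨f, hf⟩ h
    exact Subtype.ext (hb f hf (congrArg Subtype.val h))

/-- The letter in the place `i` is free; splitting by it leaves two spaces of dimension at most one.
-/
theorem finrank_jointSpace_succ_le_two {n k i : ℕ} (hi : i < n) (θ : ℕ → ℂ) (c : Fin n → Bool) :
    Module.finrank ℂ (jointSpace n k i (i + 1) θ c) ≤ 2 := by
  have hle : jointSpace n k i (i + 1) θ c ≤
      jointSpace n k i i θ (Function.update c ⟨i, hi⟩ true) ⊔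
        jointSpace n k i i θ (Function.update c ⟨i, hi⟩ false) := by
    intro f hf
    rw [← letterProj_add_letterProj ⟨i, hi⟩ f]
    exact Submodule.add_mem_sup (letterProj_mem_jointSpace (i := ⟨i, hi⟩) true hf)
      (letterProj_mem_jointSpace (i := ⟨i, hi⟩) false hf)
  have h1 := finrank_jointSpace_le_one (k := k) hi.le θ (Function.update c ⟨i, hi⟩ true)
  have h2 := finrank_jointSpace_le_one (k := k) hi.le θ (Function.update c ⟨i, hi⟩ false)
  have h3 := Submodule.finrank_mono hle
  have h4 := Submodule.finrank_add_le_finrank_add_finrank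
    (jointSpace n k i i θ (Function.update c ⟨i, hi⟩ true))
    (jointSpace n k i i θ (Function.update c ⟨i, hi⟩ false))
  omega

/-! ### Intermediate bases -/

theorem letterSubspace_apply {n k : ℕ} {j : Fin n} {b : Bool} {f : FunSpace n k}
    (hf : f ∈ letterSubspace n k j b) {x : KSet n k} (hx : f x ≠ 0) :
    j ∈ (x : Finset (Fin n)) ↔ b = true := by
  contrapose! hx
  induction hf using Submodule.span_induction with
  | mem f hf =>
    obtain ⟨y, hy, rfl⟩ := hf
    have : x ≠ y := by rintro rfl; tauto
    simp [deltaBasis, this]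
  | zero => rfl
  | add f g _ _ hf hg => simp [hf, hg]
  | smul r f _ hf => simp [hf]

theorem IsIntermediateBasis.exists_mem_jointSpace {n k i : ℕ}
    {B : Module.Basis (KSet n k) ℂ (FunSpace n k)} (hB : IsIntermediateBasis n k i B)
    (a : KSet n k) : ∃ θ c, B a ∈ jointSpace n k i i θ c := by
  obtain ⟨W, c, hW, hchain, hword⟩ := hB a
  choose! θ hθ using fun j hj => (hW j hj).exists_le_eigenspace
  -- `jointSpace` also has a condition at `j = 0`, where the operator is zero, while the isotypic
  -- conditions begin at `j = 1`.
  refine ⟨Function.update θ 0 0, c, fun j hj => ?_, fun j hj x hx => ?_⟩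
  · rcases Nat.eq_zero_or_pos j with rfl | hj0
    · simp [swapSum_zero]
    · have hj' : j ∈ Finset.Icc 1 i := Finset.mem_Icc.2 ⟨hj0, hj⟩
      simp only [chainSubspace, SetLike.mem_coe, Submodule.mem_iInf] at hchain
      rw [Function.update_of_ne hj0.ne']
      exact Module.End.mem_eigenspace_iff.1 (hθ j hj' (hchain j hj'))
  · simp only [wordSubspace, SetLike.mem_coe, Submodule.mem_iInf] at hword
    exact letterSubspace_apply (hword j hj) hx

/-- A basis vector of eigenvectors occurs in an eigenvector only if the eigenvalues agree. -/
theorem eq_of_repr_ne_zero {ι K V : Type*} [Field K] [AddCommGroup V] [Module K V]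
    (B : Module.Basis ι K V) (T : Module.End K V) {t : ι → K} (hT : ∀ a, T (B a) = t a • B a)
    {v : V} {s : K} (hv : T v = s • v) {a : ι} (ha : B.repr v a ≠ 0) : t a = s := by
  -- The coordinate functional is an eigenvector of the transpose of `T`.
  have h : B.coord a ∘ₗ T = t a • B.coord a := by
    refine B.ext fun b => ?_
    by_cases hab : b = a
    · subst hab; simp [hT]
    · simp [hT, Finsupp.single_eq_of_ne (Ne.symm hab)]
  have h' := LinearMap.congr_fun h v
  simp only [LinearMap.comp_apply, hv, map_smul, LinearMap.smul_apply, Module.Basis.coord_apply,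
    smul_eq_mul] at h'
  exact (mul_right_cancel₀ ha h').symm

/-- A prescribed letter becomes an eigenvalue, so that `eq_of_repr_ne_zero` compares letters as
well. -/
theorem letterProj_true_of_mem_jointSpace {n k i m : ℕ} {θ : ℕ → ℂ} {c : Fin n → Bool}
    {f : FunSpace n k} (hf : f ∈ jointSpace n k i m θ c) {j : Fin n} (hj : m ≤ j) :
    letterProj n k j true f = (if c j = true then (1 : ℂ) else 0) • f := by
  ext x
  by_cases hx : f x = 0
  · simp [letterProj_apply, hx]
  · simp [letterProj_apply, hf.2 j hj x hx]

theorem ncard_support_repr_le_two {n k i : ℕ} (hi : i < n)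
    {B : Module.Basis (KSet n k) ℂ (FunSpace n k)} (hB : IsIntermediateBasis n k (i + 1) B)
    {θ : ℕ → ℂ} {c : Fin n → Bool} {f : FunSpace n k} (hf : f ∈ jointSpace n k i i θ c) :
    {a | B.repr f a ≠ 0}.ncard ≤ 2 := by
  choose η d hd using hB.exists_mem_jointSpace
  -- The letter of `f` in the place `i` is lost, because vectors of `B` need not have a definite
  -- letter there.
  have hmem : ∀ a : {a | B.repr f a ≠ 0}, B a ∈ jointSpace n k i (i + 1) θ c := by
    rintro ⟨a, ha⟩
    refine ⟨fun j hj => ?_, fun j hj x hx => ?_⟩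
    · rw [(hd a).1 j (by omega), eq_of_repr_ne_zero B (swapSum n k j)
        (fun b => (hd b).1 j (by omega)) (hf.1 j hj) ha]
    · have := eq_of_repr_ne_zero B (letterProj n k j true)
        (fun b => letterProj_true_of_mem_jointSpace (hd b) hj)
        (letterProj_true_of_mem_jointSpace hf (by omega)) ha
      rw [(hd a).2 j hj x hx]
      by_cases h1 : d a j = true <;> by_cases h2 : c j = true <;> simp_all
  have hli : LinearIndependent ℂ
      (fun a : {a | B.repr f a ≠ 0} => (⟨B a, hmem a⟩ : jointSpace n k i (i + 1) θ c)) := by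
    refine LinearIndependent.of_comp (jointSpace n k i (i + 1) θ c).subtype ?_
    exact B.linearIndependent.comp _ Subtype.val_injective
  have := Fintype.ofFinite {a | B.repr f a ≠ 0}
  have h := hli.fintype_card_le_finrank
  rw [← Nat.card_eq_fintype_card, Nat.card_coe_set_eq] at h
  exact h.trans (finrank_jointSpace_succ_le_two hi θ c)


/-! ### Change of basis matrices: composition and sparsity -/

theorem changeOfBasis_mulVec_repr {n k : ℕ} (B B' : Module.Basis (KSet n k) ℂ (FunSpace n k))
    (f : FunSpace n k) : (changeOfBasis B B').mulVec (B.repr f) = B'.repr f :=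
  Module.Basis.toMatrix_mulVec_repr B B' f

theorem changeOfBasis_mul_changeOfBasis {n k : ℕ}
    (B B' B'' : Module.Basis (KSet n k) ℂ (FunSpace n k)) :
    changeOfBasis B' B'' * changeOfBasis B B' = changeOfBasis B B'' :=
  Module.Basis.toMatrix_mul_toMatrix B'' B' B

theorem prod_changeOfBasis {n k : ℕ} (B : ℕ → Module.Basis (KSet n k) ℂ (FunSpace n k)) (i m : ℕ)
    (hm : m ≤ i) : ((List.range m).map fun j => changeOfBasis (B (i - j - 1)) (B (i - j))).prod =
      changeOfBasis (B (i - m)) (B i) := by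
  induction m with
  | zero => simp [changeOfBasis, Module.Basis.toMatrix_self]
  | succ m ih =>
    rw [List.range_succ, List.map_append, List.prod_append, ih (by omega)]
    simp [changeOfBasis_mul_changeOfBasis, Nat.sub_sub]

theorem card_kSet (n k : ℕ) : Fintype.card (KSet n k) = n.choose k := by
  rw [← Nat.card_eq_fintype_card, Set.powersetCard.card, Nat.card_eq_fintype_card,
    Fintype.card_fin]

/-- The support of a matrix, as a set of pairs. -/
noncomputable def matrixSupport {K : Type*} [Fintype K] (M : Matrix K K ℂ) : Finset (K × K) := by
  classical exact Finset.univ.filter fun p => M p.1 p.2 ≠ 0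

theorem card_matrixSupport_le {K : Type*} [Fintype K] {M : Matrix K K ℂ} {c : ℕ}
    (hM : ∀ b, {a | M a b ≠ 0}.ncard ≤ c) : (matrixSupport M).card ≤ c * Fintype.card K := by
  classical
  have h : (matrixSupport M).card ≤ c * (Finset.univ : Finset K).card := by
    refine Finset.card_le_mul_card_image_of_maps_to (f := Prod.snd) (fun _ _ => Finset.mem_univ _) c
      fun b _ => ?_
    refine le_trans ?_ (hM b)
    rw [Set.ncard_eq_toFinset_card']
    refine Finset.card_le_card_of_injOn Prod.fst ?_ ?_
    · rintro ⟨a, b'⟩ h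
      simp only [matrixSupport, Finset.coe_filter, Finset.mem_filter, Finset.mem_univ, true_and,
        Set.mem_ofPred_eq] at h
      obtain ⟨h1, rfl⟩ := h
      simpa using h1
    · rintro ⟨a, b₁⟩ h₁ ⟨a', b₂⟩ h₂ h
      simp only [Finset.coe_filter, Set.mem_ofPred_eq] at h₁ h₂
      exact Prod.ext h (h₁.2.trans h₂.2.symm)
  exact h

theorem ncard_changeOfBasis_le_two {n k i : ℕ} (hi : i < n)
    {B B' : Module.Basis (KSet n k) ℂ (FunSpace n k)} (hB : IsIntermediateBasis n k i B)
    (hB' : IsIntermediateBasis n k (i + 1) B') (b : KSet n k) :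
    {a | changeOfBasis B B' a b ≠ 0}.ncard ≤ 2 := by
  obtain ⟨θ, c, h⟩ := hB.exists_mem_jointSpace b
  exact ncard_support_repr_le_two hi hB' h

end JohnsonFFT

theorem mainTheorem3 (n k : ℕ) (hn : 1 ≤ n)
    (B : ℕ → Module.Basis (JohnsonFFT.KSet n k) ℂ (JohnsonFFT.FunSpace n k))
    (hB0 : B 0 = JohnsonFFT.deltaBasis n k)
    (hB1 : B 1 = B 0)
    (hB : ∀ i ∈ Finset.Icc 1 n, JohnsonFFT.IsIntermediateBasis n k i (B i)) :
    -- each factor has at most two nonzero entries in each column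
    (∀ i ∈ Finset.Icc 2 n, ∀ b,
      {a | JohnsonFFT.changeOfBasis (B (i - 1)) (B i) a b ≠ 0}.ncard ≤ 2) ∧
    -- `[B_0]_{B_n} = [B_{n-1}]_{B_n} ⋯ [B_1]_{B_2}`
    JohnsonFFT.changeOfBasis (B 0) (B n) =
      ((List.range (n - 1)).map fun j =>
        JohnsonFFT.changeOfBasis (B (n - j - 1)) (B (n - j))).prod ∧
    -- `stage i` applies the factor `[B_{i-1}]_{B_i}`, and `P` performs the stages `2, …, n`
    ∃ (stage : ℕ → List (JohnsonFFT.Operation (JohnsonFFT.InputVar n k)))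
      (loc : ℕ → JohnsonFFT.KSet n k → JohnsonFFT.Operand (JohnsonFFT.InputVar n k))
      (P : JohnsonFFT.Program (JohnsonFFT.InputVar n k) (JohnsonFFT.KSet n k)),
      (∀ i ∈ Finset.Icc 2 n, (stage i).length ≤ 2 * n.choose k) ∧
      (∀ i ∈ Finset.Icc 1 n, ∀ f : JohnsonFFT.FunSpace n k, ∀ x,
        (loc i x).val (JohnsonFFT.inputs B f)
            (JohnsonFFT.run (JohnsonFFT.inputs B f) ((List.range' 2 (i - 1)).flatMap stage)) =
          (B i).repr f x) ∧
      P.code = (List.range' 2 (n - 1)).flatMap stage ∧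
      P.out = loc n ∧
      P.cost ≤ 2 * (n - 1) * n.choose k ∧
      ∀ f : JohnsonFFT.FunSpace n k,
        P.eval (JohnsonFFT.inputs B f) =
            (JohnsonFFT.changeOfBasis (B 0) (B n)).mulVec ((B 0).repr f) ∧
          P.eval (JohnsonFFT.inputs B f) = (B n).repr f := by
  classical
  have hsparse : ∀ i, 2 ≤ i → i ≤ n → ∀ b,
      {a | JohnsonFFT.changeOfBasis (B (i - 1)) (B i) a b ≠ 0}.ncard ≤ 2 := by
    intro i hi hin b
    obtain ⟨j, rfl⟩ : ∃ j, i = j + 1 := ⟨i - 1, by omega⟩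
    exact JohnsonFFT.ncard_changeOfBasis_le_two (by omega)
      (hB j (Finset.mem_Icc.2 (by omega))) (hB (j + 1) (Finset.mem_Icc.2 (by omega))) b
  refine ⟨fun i hi => hsparse i (Finset.mem_Icc.1 hi).1 (Finset.mem_Icc.1 hi).2, ?_, ?_⟩
  · rw [JohnsonFFT.prod_changeOfBasis B n (n - 1) (Nat.sub_le _ _), Nat.sub_sub_self hn, hB1]
  obtain ⟨stage, loc, hloc, hlen, hval⟩ := JohnsonFFT.exists_stages n (2 * n.choose k)
    -- The default outside `2, …, n` is arbitrary: no such stage enters the program.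
    (fun i a b => if hi : i ∈ Set.Icc 2 n then JohnsonFFT.InputVar.entry ⟨i, hi⟩ a b
      else JohnsonFFT.InputVar.coord a)
    -- The supports depend on the bases alone, so one program serves every `f`.
    (fun i => JohnsonFFT.matrixSupport (JohnsonFFT.changeOfBasis (B (i - 1)) (B i)))
    (fun i hi hin => (JohnsonFFT.card_matrixSupport_le (hsparse i hi hin)).trans_eq
      (by rw [JohnsonFFT.card_kSet]))
    (fun x => .var (.coord x)) (fun _ => trivial)
  have hcorrect : ∀ i, 1 ≤ i → i ≤ n → ∀ f : JohnsonFFT.FunSpace n k, ∀ x,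
      (loc i x).val (JohnsonFFT.inputs B f)
          (JohnsonFFT.run (JohnsonFFT.inputs B f) ((List.range' 2 (i - 1)).flatMap stage)) =
        (B i).repr f x := by
    intro i hi
    induction i, hi using Nat.le_induction with
    | base =>
      intro _ f x
      rw [hloc, hB1]
      rfl
    | succ i hi ih =>
      intro hin f x
      rw [Nat.add_sub_cancel, hval _ i hi,
        ← JohnsonFFT.changeOfBasis_mulVec_repr (B i) (B (i + 1)) f]
      refine Finset.sum_congr rfl fun y _ => ?_
      have hmem : i + 1 ∈ Set.Icc 2 n := ⟨by omega, hin⟩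
      rw [ih (by omega), dif_pos hmem]
      by_cases h0 : JohnsonFFT.changeOfBasis (B i) (B (i + 1)) x y = 0
      · simp [JohnsonFFT.matrixSupport, h0]
      · simp [JohnsonFFT.matrixSupport, h0, JohnsonFFT.inputs]
  refine ⟨stage, loc, ⟨(List.range' 2 (n - 1)).flatMap stage, loc n⟩,
    fun i hi => hlen i (Finset.mem_Icc.1 hi).1 (Finset.mem_Icc.1 hi).2,
    fun i hi => hcorrect i (Finset.mem_Icc.1 hi).1 (Finset.mem_Icc.1 hi).2, rfl, rfl, ?_, ?_⟩
  · rw [JohnsonFFT.Program.cost, List.length_flatMap]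
    refine (List.sum_le_card_nsmul _ (2 * n.choose k) ?_).trans_eq ?_
    · intro l hl
      obtain ⟨i, hi, rfl⟩ := List.mem_map.1 hl
      rw [List.mem_range'_1] at hi
      exact hlen i hi.1 (by omega)
    · simp
      ring
  · intro f
    have h : JohnsonFFT.Program.eval ⟨(List.range' 2 (n - 1)).flatMap stage, loc n⟩
        (JohnsonFFT.inputs B f) = (B n).repr f := funext fun x => hcorrect n hn le_rfl f x
    exact ⟨h.trans (JohnsonFFT.changeOfBasis_mulVec_repr _ _ f).symm, h⟩
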